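/- A continuous function $\rho:[0,\infty)\to[0,\infty)$ is of class $\mathcal K_\infty$ if $\rho(0)=0$ and $\rho$ is strictly increasing and unbounded. A continuous function $\beta:[0,\infty)\times[0,\infty)\to[0,\infty)$ is of class $\mathcal{KL}_0$ if $\lim_{t\to\infty}\beta(r,t)=0$ for each $r>0$ and, for each $t\ge 0$, either $\beta(\cdot,t)\in\mathcal K_\infty$ or $\beta(\cdot,t)\equiv 0$. For $\beta\in\mathcal{KL}_0$, a weight $\omega\ge 1$ and an integer $K\ge 1$ put $$B_K(r):=\sum_{n=0}^{K-2}\beta(r,n)+\omega\,\beta(r,K-1)\qquad(r\ge 0).$$ For integers $N\ge 2$ (optimization horizon) and $m\in\{1,\dots,N-1\}$ (control horizon) let $$\alpha_{N,m}^{\omega}:=\inf\ \frac{\sum_{n=0}^{N-2}\lambda_n+\omega\lambda_{N-1}-\nu}{\sum_{n=0}^{m-1}\lambda_n},$$ where the infimum is over all real $\lambda_0,\dots,\lambda_{N-1},\nu>0$ satisfying $$\sum_{n=k}^{N-2}\lambda_n+\omega\lambda_{N-1}\le B_{N-k}(\lambda_k)\qquad(k=0,\dots,N-2)$$ and $$\nu\le\sum_{n=0}^{j-1}\lambda_{n+m}+B_{N-j}(\lambda_{j+m})\qquad(j=0,\dots,N-m-1).$$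 **Proposition.** Let $\sigma\in(0,1)$, $\omega\ge1$, and let $\beta\in\mathcal{KL}_0$ satisfy $\beta(r,n)=\sigma^n r$ for all $r\ge0$ and all integers $n\ge0$ (exponential controllability with overshoot $C=1$). Then for all $N\ge2$ and $m\in\{1,\dots,N-1\}$ the infimum is over a nonempty set of values that is bounded below, and $$\alpha_{N,m}^{\omega}=\min\{1,\ 1-(1+\sigma\omega-\omega)\sigma^{N-1}\}>0 .$$ In particular, for fixed $N$, $\sigma$ and $\omega$ the value $\alpha_{N,m}^{\omega}$ does not depend on $m$. -/

import Mathlib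

/-- `ρ : [0,∞) → [0,∞)` is of class `K_∞`: continuous, zero at zero, strictly increasing and
unbounded. Functions on `[0,∞)` are modelled by real functions, of which only the values at
nonnegative arguments matter. -/
structure IsKInf (ρ : ℝ → ℝ) : Prop where
  nonneg : ∀ r, 0 ≤ r → 0 ≤ ρ r
  continuousOn : ContinuousOn ρ (Set.Ici 0)
  map_zero : ρ 0 = 0
  strictMonoOn : StrictMonoOn ρ (Set.Ici 0)
  unbounded : ¬ BddAbove (ρ '' Set.Ici 0)

/-- `β : [0,∞) × [0,∞) → [0,∞)` is of class `KL₀`: it is continuous, `β(r, t) → 0` as `t → ∞` for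
each `r > 0`, and for each `t ≥ 0` either `β(·, t)` is of class `K_∞` or `β(·, t) ≡ 0`. -/
structure IsKL0 (β : ℝ → ℝ → ℝ) : Prop where
  nonneg : ∀ r t, 0 ≤ r → 0 ≤ t → 0 ≤ β r t
  continuousOn : ContinuousOn (Function.uncurry β) (Set.Ici 0 ×ˢ Set.Ici 0)
  tendsto_zero : ∀ r, 0 < r → Filter.Tendsto (fun t => β r t) Filter.atTop (nhds 0)
  kInf_or_zero : ∀ t, 0 ≤ t → IsKInf (fun r => β r t) ∨ ∀ r, 0 ≤ r → β r t = 0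

/-- `β(r, n) = C σ^n r` for `r ≥ 0` and all natural numbers `n`, with overshoot `C ≥ 1` and decay
rate `σ ∈ (0,1)` (exponential controllability). -/
structure IsExponentialType (β : ℝ → ℝ → ℝ) (C σ : ℝ) : Prop where
  one_le_overshoot : 1 ≤ C
  decay_pos : 0 < σ
  decay_lt_one : σ < 1
  eq_exp : ∀ (r : ℝ) (n : ℕ), 0 ≤ r → β r n = C * σ ^ n * r

/-- `B_K(r) = ∑_{n=0}^{K-2} β(r, n) + ω β(r, K-1)`, for `K ≥ 1`. -/
def weightedBound (β : ℝ → ℝ → ℝ) (ω : ℝ) (K : ℕ) (r : ℝ) : ℝ :=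
  ∑ n ∈ Finset.range (K - 1), β r n + ω * β r ((K - 1 : ℕ) : ℝ)

/-- The constraints on `(λ_0, …, λ_{N-1}, ν)`. The vector `λ` is given by a sequence of which
only the entries with index `< N` are used. -/
structure IsFeasible (β : ℝ → ℝ → ℝ) (N m : ℕ) (ω : ℝ) (lam : ℕ → ℝ) (ν : ℝ) : Prop where
  lam_pos : ∀ n, n < N → 0 < lam n
  nu_pos : 0 < ν
  tail_le : ∀ k, k + 2 ≤ N →
    ∑ n ∈ Finset.Ico k (N - 1), lam n + ω * lam (N - 1) ≤ weightedBound β ω (N - k) (lam k)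
  nu_le : ∀ j, j + m + 1 ≤ N →
    ν ≤ ∑ n ∈ Finset.range j, lam (n + m) + weightedBound β ω (N - j) (lam (j + m))

/-- The objective `(∑_{n=0}^{N-2} λ_n + ω λ_{N-1} - ν) / ∑_{n=0}^{m-1} λ_n`. -/
noncomputable def performanceRatio (N m : ℕ) (ω : ℝ) (lam : ℕ → ℝ) (ν : ℝ) : ℝ :=
  (∑ n ∈ Finset.range (N - 1), lam n + ω * lam (N - 1) - ν) / ∑ n ∈ Finset.range m, lam n

/-- The set of all values of the objective at feasible points. -/
def ratioValues (β : ℝ → ℝ → ℝ) (N m : ℕ) (ω : ℝ) : Set ℝ :=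
  {a | ∃ (lam : ℕ → ℝ) (ν : ℝ), IsFeasible β N m ω lam ν ∧ a = performanceRatio N m ω lam ν}

/-- The optimal value `α_{N,m}^ω`, the infimum of the objective over all feasible points. (It is
a genuine infimum when `IsGLB (ratioValues β N m ω) (alphaOpt β N m ω)`.) -/
noncomputable def alphaOpt (β : ℝ → ℝ → ℝ) (N m : ℕ) (ω : ℝ) : ℝ :=
  sInf (ratioValues β N m ω)

/-! Write M = N - 1, θ = 1 + σω - ω, G = ∑_{n<m} σ^n and L = ∑_{n<m} λ_n. Since `B_{k+1}` is
multiplication by `gain σ ω k`, all constraints are linear. Lower bound: the last constraint on ν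
leaves a numerator of at least L - θ G λ_M. If θ ≤ 0 this is at least L. If θ ≥ 0, the tail
constraints force λ_M ≤ σ^(M-n) λ_n (`IsFeasible.last_le`), hence G λ_M ≤ σ^M L, and the ratio is at
least 1 - θσ^M. Sharpness: λ_n = σ^n attains 1 - θσ^M, and raising λ_0 without bound drives the
ratio to 1. Neither bound depends on m. -/

/-- The factor `∑_{n<k} σ^n + ω σ^k` by which `B_{k+1}` multiplies its argument. -/
def gain (σ ω : ℝ) (k : ℕ) : ℝ := ∑ n ∈ Finset.range k, σ ^ n + ω * σ ^ k

theorem gain_succ (σ ω : ℝ) (k : ℕ) : gain σ ω (k + 1) = 1 + σ * gain σ ω k := by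
  unfold gain
  rw [Finset.sum_range_succ', mul_add, Finset.mul_sum]
  simp only [pow_succ, pow_zero]
  rw [Finset.sum_congr rfl fun n _ => mul_comm (σ ^ n) σ]
  ring

theorem one_le_gain {σ ω : ℝ} (hσ : 0 < σ) (hω : 1 ≤ ω) (k : ℕ) : 1 ≤ gain σ ω k := by
  induction k with
  | zero => simpa [gain] using hω
  | succ k ih =>
    rw [gain_succ]
    nlinarith

theorem gain_add (σ ω : ℝ) (j k : ℕ) :
    gain σ ω (j + k) = ∑ n ∈ Finset.range j, σ ^ n + σ ^ j * gain σ ω k := by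
  unfold gain
  rw [Finset.sum_range_add, mul_add, Finset.mul_sum, pow_add]
  simp only [pow_add]
  ring

theorem one_sub_mul_gain (σ ω : ℝ) (k : ℕ) :
    (1 - σ) * gain σ ω k = 1 - (1 + σ * ω - ω) * σ ^ k := by
  have h := mul_neg_geom_sum σ k
  unfold gain
  linear_combination h

theorem gain_sub (σ ω : ℝ) (k : ℕ) :
    gain σ ω k - ω = (1 + σ * ω - ω) * ∑ n ∈ Finset.range k, σ ^ n := by
  have h := mul_neg_geom_sum σ k
  unfold gain
  linear_combination ω * h

theorem weightedBound_eq_gain_mul {β : ℝ → ℝ → ℝ} {σ : ℝ} (hβ : IsExponentialType β 1 σ)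
    (ω : ℝ) (K : ℕ) {r : ℝ} (hr : 0 ≤ r) :
    weightedBound β ω K r = gain σ ω (K - 1) * r := by
  unfold weightedBound gain
  rw [hβ.eq_exp r _ hr, Finset.sum_congr rfl fun n _ => hβ.eq_exp r n hr, ← Finset.sum_mul]
  simp only [one_mul]
  ring

/-- The weighted tail `∑_{n=k}^{M-1} λ_n + ω λ_M`. -/
def weightedTail (M : ℕ) (ω : ℝ) (lam : ℕ → ℝ) (k : ℕ) : ℝ :=
  ∑ n ∈ Finset.Ico k M, lam n + ω * lam M

theorem weightedTail_of_lt {M k : ℕ} (ω : ℝ) (lam : ℕ → ℝ) (hk : k < M) :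
    weightedTail M ω lam k = lam k + weightedTail M ω lam (k + 1) := by
  unfold weightedTail
  rw [Finset.sum_eq_sum_Ico_succ_bot hk, add_assoc]

theorem weightedTail_zero {M m : ℕ} (ω : ℝ) (lam : ℕ → ℝ) (hm : m ≤ M) :
    ∑ n ∈ Finset.range M, lam n + ω * lam M =
      ∑ n ∈ Finset.range m, lam n + weightedTail M ω lam m := by
  unfold weightedTail
  rw [← Finset.sum_range_add_sum_Ico lam hm, add_assoc]

theorem weightedTail_pow {M k : ℕ} (σ ω : ℝ) (hk : k ≤ M) :
    weightedTail M ω (fun n => σ ^ n) k = σ ^ k * gain σ ω (M - k) := by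
  obtain ⟨d, rfl⟩ := Nat.exists_eq_add_of_le hk
  unfold weightedTail gain
  rw [Finset.sum_Ico_eq_sum_range, Nat.add_sub_cancel_left, mul_add, Finset.mul_sum]
  simp only [pow_add]
  ring

section LowerBound

variable {β : ℝ → ℝ → ℝ} {σ ω ν : ℝ} {M m : ℕ} {lam : ℕ → ℝ}

theorem IsFeasible.weightedTail_le (hβ : IsExponentialType β 1 σ)
    (hf : IsFeasible β (M + 1) m ω lam ν) {k : ℕ} (hk : k < M) :
    weightedTail M ω lam k ≤ gain σ ω (M - k) * lam k := by
  have h := hf.tail_le k (by omega)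
  rw [weightedBound_eq_gain_mul hβ ω _ (hf.lam_pos k (by omega)).le] at h
  simpa [weightedTail, show M + 1 - k - 1 = M - k by omega] using h

/-- Along a feasible sequence the last entry is at most what geometric decay predicts. -/
theorem IsFeasible.last_le (hβ : IsExponentialType β 1 σ) (hω : 1 ≤ ω)
    (hf : IsFeasible β (M + 1) m ω lam ν) (d k : ℕ) (hdk : k + d = M) :
    lam M ≤ σ ^ d * lam k ∧ gain σ ω d * lam M ≤ σ ^ d * weightedTail M ω lam k := by
  have hσ := hβ.decay_pos
  -- The tail estimate is carried along for the induction: the constraint at k bounds the tail from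
  -- k + 1 by σ · gain · λ_k, and the inductive tail estimate turns this into a bound on λ_M.
  induction d generalizing k with
  | zero =>
    obtain rfl : k = M := by omega
    simp [gain, weightedTail]
  | succ d ih =>
    obtain ⟨-, ih⟩ := ih (k + 1) (by omega)
    have hg : 0 < gain σ ω d := by linarith [one_le_gain hσ hω d]
    have htail := hf.weightedTail_le hβ (show k < M by omega)
    rw [weightedTail_of_lt ω lam (by omega), show M - k = d + 1 by omega, gain_succ] at htail
    have hnext : weightedTail M ω lam (k + 1) ≤ σ * gain σ ω d * lam k := by linarith
    have hlast : lam M ≤ σ ^ (d + 1) * lam k := by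
      have := mul_le_mul_of_nonneg_left hnext (pow_pos hσ d).le
      refine le_of_mul_le_mul_left ?_ hg
      calc gain σ ω d * lam M ≤ σ ^ d * (σ * gain σ ω d * lam k) := ih.trans this
        _ = gain σ ω d * (σ ^ (d + 1) * lam k) := by ring
    refine ⟨hlast, ?_⟩
    rw [weightedTail_of_lt ω lam (by omega), gain_succ]
    calc (1 + σ * gain σ ω d) * lam M = lam M + σ * (gain σ ω d * lam M) := by ring
      _ ≤ σ ^ (d + 1) * lam k + σ * (σ ^ d * weightedTail M ω lam (k + 1)) := by gcongr
      _ = σ ^ (d + 1) * (lam k + weightedTail M ω lam (k + 1)) := by ring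

theorem IsFeasible.last_mul_geom_sum_le (hβ : IsExponentialType β 1 σ) (hω : 1 ≤ ω)
    (hf : IsFeasible β (M + 1) m ω lam ν) (hm : m ≤ M) :
    (∑ n ∈ Finset.range m, σ ^ n) * lam M ≤ σ ^ M * ∑ n ∈ Finset.range m, lam n := by
  rw [Finset.sum_mul, Finset.mul_sum]
  refine Finset.sum_le_sum fun n hn => ?_
  have hn' : n + (M - n) = M := by have := Finset.mem_range.1 hn; omega
  have h := (hf.last_le hβ hω (M - n) n hn').1
  calc σ ^ n * lam M ≤ σ ^ n * (σ ^ (M - n) * lam n) :=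
        mul_le_mul_of_nonneg_left h (pow_pos hβ.decay_pos n).le
    _ = σ ^ M * lam n := by rw [← mul_assoc, ← pow_add, hn']

theorem IsFeasible.nu_le_weightedTail_add (hβ : IsExponentialType β 1 σ)
    (hf : IsFeasible β (M + 1) m ω lam ν) (hm : m ≤ M) :
    ν ≤ weightedTail M ω lam m +
      (1 + σ * ω - ω) * ((∑ n ∈ Finset.range m, σ ^ n) * lam M) := by
  -- The largest admissible j: its bound involves the actual tail up to λ_M, so the tail cancels in
  -- the numerator.
  have h := hf.nu_le (M - m) (by omega)
  rw [Nat.sub_add_cancel hm, weightedBound_eq_gain_mul hβ ω _ (hf.lam_pos M (by omega)).le,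
    show M + 1 - (M - m) - 1 = m by omega] at h
  have hs : ∑ n ∈ Finset.range (M - m), lam (n + m) = ∑ n ∈ Finset.Ico m M, lam n := by
    rw [Finset.sum_Ico_eq_sum_range]
    simp only [add_comm]
  rw [hs] at h
  have hg := gain_sub σ ω m
  unfold weightedTail
  linear_combination h + lam M * hg

theorem IsFeasible.le_performanceRatio (hβ : IsExponentialType β 1 σ) (hω : 1 ≤ ω)
    (hf : IsFeasible β (M + 1) m ω lam ν) (hm1 : 1 ≤ m) (hm : m ≤ M) :
    min 1 (1 - (1 + σ * ω - ω) * σ ^ M) ≤ performanceRatio (M + 1) m ω lam ν := by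
  have hL : 0 < ∑ n ∈ Finset.range m, lam n :=
    Finset.sum_pos (fun n hn => hf.lam_pos n (by have := Finset.mem_range.1 hn; omega))
      ⟨0, Finset.mem_range.2 hm1⟩
  have hν := hf.nu_le_weightedTail_add hβ hm
  have hlast := hf.last_mul_geom_sum_le hβ hω hm
  have hM := hf.lam_pos M (by omega)
  have hG : 0 ≤ ∑ n ∈ Finset.range m, σ ^ n :=
    Finset.sum_nonneg fun n _ => (pow_pos hβ.decay_pos n).le
  unfold performanceRatio
  rw [le_div_iff₀ hL, Nat.add_sub_cancel, weightedTail_zero ω lam hm]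
  rcases le_total 0 (1 + σ * ω - ω) with hθ | hθ
  · have h1 := mul_le_mul_of_nonneg_right
      (min_le_right 1 (1 - (1 + σ * ω - ω) * σ ^ M)) hL.le
    have h2 := mul_le_mul_of_nonneg_left hlast hθ
    linarith
  · have h1 := mul_le_mul_of_nonneg_right
      (min_le_left 1 (1 - (1 + σ * ω - ω) * σ ^ M)) hL.le
    have h2 := mul_nonpos_of_nonpos_of_nonneg hθ (mul_nonneg hG hM.le)
    linarith

end LowerBound

/-- The geometric sequence `σ^n` with its initial entry raised by `s`. -/
def raisedGeom (σ s : ℝ) (n : ℕ) : ℝ := σ ^ n + if n = 0 then s else 0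

theorem raisedGeom_of_pos (σ s : ℝ) {n : ℕ} (hn : 0 < n) : raisedGeom σ s n = σ ^ n := by
  simp [raisedGeom, hn.ne']

theorem sum_range_raisedGeom (σ s : ℝ) {m : ℕ} (hm : 0 < m) :
    ∑ n ∈ Finset.range m, raisedGeom σ s n = s + ∑ n ∈ Finset.range m, σ ^ n := by
  simp [raisedGeom, Finset.sum_add_distrib, hm, add_comm]

theorem weightedTail_raisedGeom (σ ω s : ℝ) {M k : ℕ} (hk : 0 < k) (hkM : k ≤ M) :
    weightedTail M ω (raisedGeom σ s) k = σ ^ k * gain σ ω (M - k) := by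
  rw [← weightedTail_pow σ ω hkM]
  unfold weightedTail
  rw [raisedGeom_of_pos σ s (hk.trans_le hkM), Finset.sum_congr rfl fun n hn =>
    raisedGeom_of_pos σ s (hk.trans_le (Finset.mem_Ico.1 hn).1)]

section UpperBound

variable {β : ℝ → ℝ → ℝ} {σ ω s : ℝ} {M m : ℕ}

/-- For s = 0 all constraints hold with equality. Raising λ_0 affects only the tail constraint at k
= 0, which stays valid because the gain is at least 1; as m ≥ 1, λ_0 is absent from the bounds on ν.
-/
theorem isFeasible_raisedGeom (hβ : IsExponentialType β 1 σ) (hω : 1 ≤ ω) (hs : 0 ≤ s)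
    (hm1 : 1 ≤ m) :
    IsFeasible β (M + 1) m ω (raisedGeom σ s) (σ ^ m * gain σ ω M) := by
  have hσ := hβ.decay_pos
  have hpos : ∀ n, 0 < raisedGeom σ s n := fun n => by
    have := pow_pos hσ n
    unfold raisedGeom
    split_ifs <;> linarith
  refine ⟨fun n _ => hpos n,
    mul_pos (pow_pos hσ m) (by linarith [one_le_gain hσ hω M]), fun k hk => ?_, fun j hj => ?_⟩
  · rw [weightedBound_eq_gain_mul hβ ω _ (hpos k).le, show M + 1 - k - 1 = M - k by omega,
      Nat.add_sub_cancel]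
    change weightedTail M ω (raisedGeom σ s) k ≤ _
    rcases Nat.eq_zero_or_pos k with rfl | hk0
    · have hg := one_le_gain hσ hω M
      obtain ⟨M, rfl⟩ : ∃ d, M = d + 1 := ⟨M - 1, by omega⟩
      rw [weightedTail_of_lt ω _ (Nat.succ_pos M),
        weightedTail_raisedGeom σ ω s (Nat.succ_pos 0) (by omega)]
      simp only [raisedGeom, if_true, pow_zero, pow_one, Nat.sub_zero]
      rw [gain_succ] at hg ⊢
      rw [show M.succ - Nat.succ 0 = M by omega]
      nlinarith
    · rw [weightedTail_raisedGeom σ ω s hk0 (by omega), raisedGeom_of_pos σ s hk0, mul_comm]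
  · rw [weightedBound_eq_gain_mul hβ ω _ (hpos _).le, raisedGeom_of_pos σ s (by omega),
      Finset.sum_congr rfl fun n _ => raisedGeom_of_pos σ s (show 0 < n + m by omega),
      show M + 1 - j - 1 = M - j by omega]
    have h := gain_add σ ω j (M - j)
    rw [Nat.add_sub_cancel' (by omega)] at h
    simp only [pow_add]
    rw [h, ← Finset.sum_mul]
    apply le_of_eq
    ring

theorem performanceRatio_raisedGeom (hm1 : 1 ≤ m) (hm : m ≤ M) :
    performanceRatio (M + 1) m ω (raisedGeom σ s) (σ ^ m * gain σ ω M) =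
      (s + (1 - (1 + σ * ω - ω) * σ ^ M) * ∑ n ∈ Finset.range m, σ ^ n) /
        (s + ∑ n ∈ Finset.range m, σ ^ n) := by
  unfold performanceRatio
  rw [sum_range_raisedGeom σ s hm1, Nat.add_sub_cancel, weightedTail_zero ω _ hm,
    sum_range_raisedGeom σ s hm1, weightedTail_raisedGeom σ ω s hm1 hm]
  congr 1
  have h := gain_add σ ω m (M - m)
  rw [Nat.add_sub_cancel' hm] at h
  have h1 := one_sub_mul_gain σ ω M
  have h2 := mul_neg_geom_sum σ m
  linear_combination (-1) * h + (∑ n ∈ Finset.range m, σ ^ n) * h1 - gain σ ω M * h2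

/-- The quantity equals (1 - σ) `gain σ ω M`, a product of positive factors. -/
theorem one_sub_mul_pow_pos (hβ : IsExponentialType β 1 σ) (hω : 1 ≤ ω) (M : ℕ) :
    0 < 1 - (1 + σ * ω - ω) * σ ^ M := by
  rw [← one_sub_mul_gain]
  exact mul_pos (by linarith [hβ.decay_lt_one]) (by linarith [one_le_gain hβ.decay_pos hω M])

theorem isGLB_ratioValues (hβ : IsExponentialType β 1 σ) (hω : 1 ≤ ω) (hm1 : 1 ≤ m)
    (hm : m ≤ M) :
    IsGLB (ratioValues β (M + 1) m ω) (min 1 (1 - (1 + σ * ω - ω) * σ ^ M)) := by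
  refine ⟨?_, fun b hb => ?_⟩
  · rintro _ ⟨lam, ν, hf, rfl⟩
    exact hf.le_performanceRatio hβ hω hm1 hm
  have hG : 0 < ∑ n ∈ Finset.range m, σ ^ n :=
    Finset.sum_pos (fun n _ => pow_pos hβ.decay_pos n) ⟨0, Finset.mem_range.2 hm1⟩
  have hc := one_sub_mul_pow_pos hβ hω M
  have key : ∀ s, 0 ≤ s → b * (s + ∑ n ∈ Finset.range m, σ ^ n) ≤
      s + (1 - (1 + σ * ω - ω) * σ ^ M) * ∑ n ∈ Finset.range m, σ ^ n := fun s hs => by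
    rw [← le_div_iff₀ (by linarith), ← performanceRatio_raisedGeom hm1 hm]
    exact hb ⟨_, _, isFeasible_raisedGeom hβ hω hs hm1, rfl⟩
  set c := 1 - (1 + σ * ω - ω) * σ ^ M
  set G := ∑ n ∈ Finset.range m, σ ^ n
  refine le_min ?_ ?_
  · by_contra! h
    have hb1 : 0 < b - 1 := by linarith
    -- If b > 1, this s makes (b - 1)s equal cG, so `key` would give bG ≤ 0.
    have h1 := key (c * G / (b - 1)) (by positivity)
    have h2 : (b - 1) * (c * G / (b - 1)) = c * G := by field_simp
    have h3 : 0 < b * G := by positivity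
    linarith
  · have h := key 0 le_rfl
    rw [zero_add, zero_add] at h
    exact le_of_mul_le_mul_right h hG

theorem ratioValues_nonempty (hβ : IsExponentialType β 1 σ) (hω : 1 ≤ ω) (hm1 : 1 ≤ m) :
    (ratioValues β (M + 1) m ω).Nonempty :=
  ⟨_, _, _, isFeasible_raisedGeom hβ hω le_rfl hm1, rfl⟩

end UpperBound

theorem proposition6p2 (β : ℝ → ℝ → ℝ) (hKL : IsKL0 β) (σ : ℝ) (hβ : IsExponentialType β 1 σ)
    (ω : ℝ) (hω : 1 ≤ ω) (N : ℕ) :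
    (∀ m : ℕ, 1 ≤ m → m + 1 ≤ N →
      IsGLB (ratioValues β N m ω) (alphaOpt β N m ω) ∧
      alphaOpt β N m ω = min 1 (1 - (1 + σ * ω - ω) * σ ^ (N - 1)) ∧
      0 < alphaOpt β N m ω) ∧
    (∀ m m' : ℕ, 1 ≤ m → m + 1 ≤ N → 1 ≤ m' → m' + 1 ≤ N →
      alphaOpt β N m ω = alphaOpt β N m' ω) := by
  have main : ∀ m : ℕ, 1 ≤ m → m + 1 ≤ N →
      IsGLB (ratioValues β N m ω) (alphaOpt β N m ω) ∧
      alphaOpt β N m ω = min 1 (1 - (1 + σ * ω - ω) * σ ^ (N - 1)) ∧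
      0 < alphaOpt β N m ω := by
    intro m hm1 hm
    obtain ⟨M, rfl⟩ : ∃ M, N = M + 1 := ⟨N - 1, by omega⟩
    have hglb := isGLB_ratioValues hβ hω hm1 (show m ≤ M by omega)
    have heq : alphaOpt β (M + 1) m ω = min 1 (1 - (1 + σ * ω - ω) * σ ^ M) :=
      hglb.csInf_eq (ratioValues_nonempty hβ hω hm1)
    rw [heq]
    exact ⟨hglb, rfl, lt_min one_pos (one_sub_mul_pow_pos hβ hω M)⟩
  refine ⟨main, fun m m' hm1 hm hm1' hm' => ?_⟩
  rw [(main m hm1 hm).2.1, (main m' hm1' hm').2.1]
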